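/- For graphs $G$ (with edge set $E(G)$) and $H$, the edge corona $G \circledcirc H$ is the graph obtained from one copy of $G$ and one disjoint copy $H_e$ of $H$ for every edge $e\in E(G)$ by joining both end vertices of $e$ to every vertex of $H_e$. Let $q\ge 1$ be an integer, let $\mathcal{G}_q(0)=K_{q+2}$ be the complete graph on $q+2$ vertices, and let $\mathcal{G}_q(g+1)=\mathcal{G}_q(g)\circledcirc K_q$ for all integers $g\ge 0$. Let $N_q(g)$ and $M_q(g)$ be the numbers of vertices and of edges of $\mathcal{G}_q(g)$, and let $\tau_q(g)$ be the number of spanning trees of $\mathcal{G}_q(g)$. Then for all $g\ge 0$, $$\tau_q(g)=2^{\frac{2(q+1)}{q(q+3)^2}\left[\frac{(q+1)(q+2)}{2}\right]^{g+1}-\frac{q+1}{q+3}\,g-\frac{(q+1)^2(q+2)}{q(q+3)^2}}\cdot (q+2)^{\frac{2(q^2+2q-1)}{q(q+3)^2}\left[\frac{(q+1)(q+2)}{2}\right]^{g+1}+\frac{q+1}{q+3}\,g+\frac{q^3+2q^2-q+2}{q(q+3)^2}} .$$ Moreover, $\tau_q(0)=(q+2)^q$, and for all $g\ge 0$, $$\tau_q(g+1)=2^{M_q(g)-N_q(g)+1}\,(q+2)^{(q-1)M_q(g)+N_q(g)-1}\,\tau_q(g).$$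 -/

import Mathlib

/-- The edge corona of `G` and `H`: one copy of `G` and, for every edge `e` of `G`, one copy of `H`
(on the vertices `(e, w)`), every vertex of which is joined to both end vertices of `e`. -/
def edgeCorona {V W : Type} (G : SimpleGraph V) (H : SimpleGraph W) :
    SimpleGraph (V ⊕ (G.edgeSet × W)) where
  Adj x y :=
    match x, y with
    | Sum.inl u, Sum.inl v => G.Adj u v
    | Sum.inl u, Sum.inr p => u ∈ (p.1 : Sym2 V)
    | Sum.inr p, Sum.inl v => v ∈ (p.1 : Sym2 V)
    | Sum.inr p, Sum.inr p' => p.1 = p'.1 ∧ H.Adj p.2 p'.2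
  symm := ⟨by
    rintro (u | p) (v | p') h
    · exact SimpleGraph.Adj.symm h
    · exact h
    · exact h
    · exact ⟨h.1.symm, SimpleGraph.Adj.symm h.2⟩⟩
  loopless := ⟨by
    rintro (u | p) h
    · exact G.irrefl h
    · exact H.irrefl h.2⟩

/-- The vertex type and the graph of the simplicial network after `g` iterations: start from the
complete graph on `q + 2` vertices and repeatedly take the edge corona with the complete graph
on `q` vertices. -/
def simplicialNetwork (q : ℕ) : ℕ → (V : Type) × SimpleGraph V
  | 0 => ⟨Fin (q + 2), ⊤⟩
  | g + 1 => ⟨_, edgeCorona (simplicialNetwork q g).2 (⊤ : SimpleGraph (Fin q))⟩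

/-- The vertex type of the simplicial network. -/
abbrev SimplicialVertex (q g : ℕ) : Type := (simplicialNetwork q g).1

/-- The simplicial network `G_q(g)`. -/
abbrev simplicialGraph (q g : ℕ) : SimpleGraph (SimplicialVertex q g) := (simplicialNetwork q g).2

/-- The number of spanning trees of a (finite) graph `G`: subgraphs of `G` on the whole vertex set
that are trees. -/
noncomputable def numSpanningTrees {V : Type} (G : SimpleGraph V) : ℕ :=
  Nat.card {T : SimpleGraph V // T ≤ G ∧ T.IsTree}

/-- The number of vertices of `G_q(g)`. -/
noncomputable def simplicialOrder (q g : ℕ) : ℕ := Nat.card (SimplicialVertex q g)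

/-- The number of edges of `G_q(g)`. -/
noncomputable def simplicialSize (q g : ℕ) : ℕ := Nat.card (simplicialGraph q g).edgeSet

/-! Ground the Laplacian at a vertex `r` by adding `t` to its `(r, r)` entry. By the matrix-tree
theorem, scaling the Laplacian by `c` first gives determinant `t * c ^ (N - 1) * τ`, where `N`
counts vertices and `τ` spanning trees (`SimpleGraph.det_groundedLapMatrix`). It comes from a
factorization through an incidence matrix and Cauchy–Binet: the nonzero minors are the spanning
trees, each `±1`.

In the edge corona with `K_q`, every copy contributes a diagonal block `(q+2)I - J`, with `J` all
ones. Its row sums are `2`, so eliminating all copies subtracts `(q/2)(D + A)` from `(q+1)D - A`,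
where `D` and `A` are the degree and adjacency matrices of `G`. What remains is `(q+2)/2` times the
Laplacian of `G`, again grounded at `r` (`SimpleGraph.det_groundedLapMatrix_edgeCorona`). Each of
the `M` blocks has determinant `2(q+2)^(q-1)` and the scaling gives `((q+2)/2)^(N-1)`, hence the
recursion. Closed forms for `M` and `N` and induction on `g` yield the formula. -/

/-! ### Cauchy–Binet, summed over all maps from rows to columns. -/

open Matrix in
theorem Matrix.det_mul_eq_sum_det_submatrix {n m R : Type*} [Fintype n] [DecidableEq n] [Fintype m]
    [CommRing R] (A : Matrix n m R) (B : Matrix m n R) :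
    (A * B).det = ∑ p : n → m, (∏ i, B (p i) i) * (A.submatrix id p).det := by
  classical
  simp only [det_apply', mul_apply, Finset.prod_univ_sum, Finset.mul_sum, Fintype.piFinset_univ,
    submatrix_apply, id]
  rw [Finset.sum_comm]
  refine Finset.sum_congr rfl fun p _ => Finset.sum_congr rfl fun σ _ => ?_
  rw [Finset.prod_mul_distrib]
  ring

/-- A form of the Cauchy–Binet formula in which every minor is counted once for each ordering of
its columns. -/
theorem Matrix.factorial_mul_det_mul_diagonal_mul_transpose {n m R : Type*} [Fintype n]
    [DecidableEq n] [Fintype m] [DecidableEq m] [CommRing R] (A : Matrix n m R) (d : m → R) :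
    ((Fintype.card n).factorial : R) * (A * Matrix.diagonal d * A.transpose).det =
      ∑ p : n → m, (∏ i, d (p i)) * (A.submatrix id p).det ^ 2 := by
  -- The same determinant is expanded once for each `σ`, after permuting the indices of `p`. Summing
  -- over all `σ` reassembles the second factor `det` and produces the factorial.
  have key : ∀ σ : Equiv.Perm n, (A * Matrix.diagonal d * A.transpose).det =
      ∑ p : n → m, (∏ i, d (p i)) * (((Equiv.Perm.sign σ : ℤ) : R) * ∏ i, A (σ i) (p i)) *
        (A.submatrix id p).det := by
    intro σ
    rw [Matrix.mul_assoc, Matrix.det_mul_eq_sum_det_submatrix,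
      ← Equiv.sum_comp (Equiv.arrowCongr σ (Equiv.refl m))]
    refine Finset.sum_congr rfl fun p _ => ?_
    have hp : (Equiv.arrowCongr σ (Equiv.refl m)) p = p ∘ σ.symm := rfl
    have hdet : (A.submatrix id (p ∘ σ.symm)).det =
        ((Equiv.Perm.sign σ : ℤ) : R) * (A.submatrix id p).det := by
      have h := Matrix.det_permute' σ.symm (A.submatrix id p)
      rwa [Equiv.Perm.sign_symm] at h
    have hprod : ∏ i, (Matrix.diagonal d * A.transpose) ((p ∘ σ.symm) i) i =
        (∏ i, d (p i)) * ∏ i, A (σ i) (p i) := by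
      rw [← Equiv.prod_comp σ, ← Finset.prod_mul_distrib]
      simp [Matrix.diagonal_mul]
    rw [hp, hprod, hdet]
    ring
  have h : ∑ _σ : Equiv.Perm n, (A * Matrix.diagonal d * A.transpose).det =
      ((Fintype.card n).factorial : R) * (A * Matrix.diagonal d * A.transpose).det := by
    simp [Fintype.card_perm]
  rw [← h, Finset.sum_congr rfl fun σ _ => key σ, Finset.sum_comm]
  refine Finset.sum_congr rfl fun p _ => ?_
  rw [sq, Matrix.det_apply' (A.submatrix id p), ← Finset.sum_mul, ← Finset.mul_sum, mul_assoc]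
  rfl

/-! ### Minors of the grounded incidence matrix and spanning trees. -/

namespace SimpleGraph

variable {V : Type*}

/-- The columns of the grounded incidence matrix that belong to the edges of `T`, and the extra
column. -/
def groundedEdgeSet (T : SimpleGraph V) : Set (Option (Sym2 V)) :=
  insert none (some '' T.edgeSet)

theorem groundedEdgeSet_injective :
    Function.Injective (groundedEdgeSet : SimpleGraph V → Set (Option (Sym2 V))) := by
  intro T T' h
  rw [← edgeSet_inj]
  ext e
  have : some e ∈ T.groundedEdgeSet ↔ some e ∈ T'.groundedEdgeSet := by rw [h]
  simpa [groundedEdgeSet] using this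

theorem ncard_groundedEdgeSet [Finite V] (T : SimpleGraph V) :
    T.groundedEdgeSet.ncard = Nat.card T.edgeSet + 1 := by
  rw [groundedEdgeSet, Set.ncard_insert_of_notMem (by simp) (Set.toFinite _),
    Set.ncard_image_of_injective _ (Option.some_injective _), Nat.card_coe_set_eq]

theorem out_mk_eq (e : Sym2 V) : s((Quot.out e).1, (Quot.out e).2) = e := Quot.out_eq e

variable [DecidableEq V]

/-- The signed vertex-edge incidence matrix of the complete graph on `V`, each pair being oriented
arbitrarily, with one more column, indexed by `none`, which is the unit vector at `r`. -/
noncomputable def groundedIncMatrix (r : V) : Matrix V (Option (Sym2 V)) ℤ :=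
  Matrix.of fun v o => o.elim (Pi.single (M := fun _ => ℤ) r 1 v) fun e =>
    Pi.single (M := fun _ => ℤ) (Quot.out e).1 1 v - Pi.single (M := fun _ => ℤ) (Quot.out e).2 1 v

/-- The grounded incidence matrix over the reals. -/
noncomputable def realGroundedIncMatrix (r : V) : Matrix V (Option (Sym2 V)) ℝ :=
  (groundedIncMatrix r).map fun x => (x : ℝ)

theorem groundedIncMatrix_none (r : V) : (fun v => groundedIncMatrix r v none) = Pi.single r 1 := by
  ext v; rfl

theorem groundedIncMatrix_some (r : V) (u v : V) :
    (fun x => groundedIncMatrix r x (some s(u, v))) = Pi.single u 1 - Pi.single v 1 ∨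
    (fun x => groundedIncMatrix r x (some s(u, v))) = Pi.single v 1 - Pi.single u 1 := by
  have h := out_mk_eq s(u, v)
  rw [Sym2.eq_iff] at h
  rcases h with ⟨h1, h2⟩ | ⟨h1, h2⟩
  · left
    ext x
    simp only [groundedIncMatrix, Matrix.of_apply, Option.elim, h1, h2, Pi.sub_apply]
  · right
    ext x
    simp only [groundedIncMatrix, Matrix.of_apply, Option.elim, h1, h2, Pi.sub_apply]

variable [Fintype V]

/-- The columns span `V → ℤ` over the integers: the extra column is the unit vector at `r`, and
adding edge columns along a walk carries it to any vertex. Working over `ℤ` is what forces the minor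
to be `±1`. -/
theorem isUnit_det_groundedIncMatrix_submatrix (r : V) {T : SimpleGraph V} (hT : T.Connected)
    {p : V → Option (Sym2 V)} (hp : T.groundedEdgeSet ⊆ Set.range p) :
    IsUnit ((groundedIncMatrix r).submatrix id p).det := by
  rw [← Matrix.isUnit_iff_isUnit_det, ← Matrix.mulVec_surjective_iff_isUnit]
  set N := (groundedIncMatrix r).submatrix id p with hN
  let S : Submodule ℤ (V → ℤ) := LinearMap.range N.mulVecLin
  have hcol : ∀ o ∈ T.groundedEdgeSet, (fun v => groundedIncMatrix r v o) ∈ S := by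
    intro o ho
    obtain ⟨i, rfl⟩ := hp ho
    refine ⟨Pi.single i 1, ?_⟩
    ext v
    simp [hN]
  have hr : (Pi.single r 1 : V → ℤ) ∈ S := by
    rw [← groundedIncMatrix_none r]
    exact hcol none (by simp [groundedEdgeSet])
  have hadj : ∀ u v, T.Adj u v → (Pi.single u 1 - Pi.single v 1 : V → ℤ) ∈ S := by
    intro u v huv
    have h := hcol (some s(u, v)) (by simpa [groundedEdgeSet] using huv)
    rcases groundedIncMatrix_some r u v with h' | h'
    · rwa [h'] at h
    · rw [h'] at h
      simpa using S.neg_mem h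
  have hall : ∀ u, (Pi.single u 1 : V → ℤ) ∈ S := by
    have hwalk : ∀ {u v}, T.Walk u v → (Pi.single v 1 : V → ℤ) ∈ S →
        (Pi.single u 1 : V → ℤ) ∈ S := by
      intro u v w hv
      induction w with
      | nil => exact hv
      | cons h _ ih => simpa using S.add_mem (hadj _ _ h) (ih hv)
    intro u
    obtain ⟨w⟩ := hT.preconnected u r
    exact hwalk w hr
  intro y
  have hy : y ∈ S := by
    rw [pi_eq_sum_univ' y]
    exact S.sum_mem fun i _ => S.smul_mem _ (hall i)
  exact hy

/-- A nonsingular minor has no repeated column and no nonzero left kernel vector. Suitable test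
vectors then show that the extra column is used and that the chosen edges connect every vertex to
`r`; counting columns gives a tree. -/
theorem exists_isTree_of_det_groundedIncMatrix_submatrix_ne_zero (r : V) (G : SimpleGraph V)
    {p : V → Option (Sym2 V)} (hG : ∀ i e, p i = some e → e ∈ G.edgeSet)
    (hdet : ((groundedIncMatrix r).submatrix id p).det ≠ 0) :
    Function.Injective p ∧ ∃ T : SimpleGraph V, T ≤ G ∧ T.IsTree ∧
      T.groundedEdgeSet = Set.range p := by
  have hinj : Function.Injective p := by
    intro i j hij
    by_contra hne
    exact hdet (Matrix.det_zero_of_column_eq hne fun k => by simp [hij])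
  have hker : ∀ x : V → ℤ, (∀ i, ∑ v, x v * groundedIncMatrix r v (p i) = 0) → x = 0 := by
    intro x hx
    by_contra hne
    refine hdet (Matrix.exists_vecMul_eq_zero_iff.1 ⟨x, hne, ?_⟩)
    ext i
    simpa [Matrix.vecMul, dotProduct] using hx i
  have hsome : ∀ (x : V → ℤ) u v, x u = x v →
      ∑ w, x w * groundedIncMatrix r w (some s(u, v)) = 0 := by
    intro x u v h
    change x ⬝ᵥ (fun w => groundedIncMatrix r w (some s(u, v))) = 0
    rcases groundedIncMatrix_some r u v with h' | h' <;> rw [h'] <;> simp [dotProduct_sub, h]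
  let T := fromEdgeSet {e | some e ∈ Set.range p}
  have hedge : T.edgeSet = {e | some e ∈ Set.range p} := by
    rw [edgeSet_fromEdgeSet, sdiff_eq_left, Set.disjoint_left]
    rintro e ⟨i, hi⟩ he
    exact G.not_isDiag_of_mem_edgeSet (hG i e hi) he
  -- The constant vector is orthogonal to every edge column, so edge columns alone are singular.
  have hnone : none ∈ Set.range p := by
    by_contra hn
    have := hker (fun _ => 1) fun i => by
      cases h : p i with
      | none => exact absurd ⟨i, h⟩ hn
      | some e =>
        induction e with
        | _ u v => exact hsome _ _ _ rfl
    simpa using congrFun this r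
  have hS : T.groundedEdgeSet = Set.range p := by
    ext o
    cases o with
    | none => simpa [groundedEdgeSet] using hnone
    | some e => simp [groundedEdgeSet, hedge]
  refine ⟨hinj, T, ?_, ?_, hS⟩
  · rw [← edgeSet_subset_edgeSet, hedge]
    rintro e ⟨i, hi⟩
    exact hG i e hi
  · rw [isTree_iff_connected_and_card]
    constructor
    · have : Nonempty V := ⟨r⟩
      rw [connected_iff_exists_forall_reachable]
      refine ⟨r, fun v => ?_⟩
      by_contra hv
      classical
      -- The indicator of the vertices not reachable from `r` vanishes at `r` and is constant on
      -- components, so it is orthogonal to all chosen columns.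
      have := hker (fun u => if T.Reachable r u then 0 else 1) fun i => by
        cases h : p i with
        | none =>
          change (fun u => if T.Reachable r u then (0 : ℤ) else 1) ⬝ᵥ
            (fun w => groundedIncMatrix r w none) = 0
          rw [groundedIncMatrix_none]
          simp
        | some e =>
          induction e with
          | _ u v =>
            have hadj : T.Adj u v := by
              rw [← mem_edgeSet, hedge]
              exact ⟨i, h⟩
            refine hsome _ _ _ ?_
            have : T.Reachable r u ↔ T.Reachable r v :=
              ⟨fun h => h.trans hadj.reachable, fun h => h.trans hadj.symm.reachable⟩
            simp [this]
      simpa [hv] using congrFun this v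
    · rw [← ncard_groundedEdgeSet, hS, ← Set.image_univ, Set.ncard_image_of_injective _ hinj,
        Set.ncard_univ]

theorem card_injective_range_eq (S : Set (Option (Sym2 V))) (hS : S.ncard = Fintype.card V) :
    Nat.card {p : V → Option (Sym2 V) // Function.Injective p ∧ S = Set.range p} =
      (Fintype.card V).factorial := by
  classical
  have hc : Fintype.card V = Fintype.card S := by
    rw [← hS, ← Nat.card_eq_fintype_card, Nat.card_coe_set_eq]
  let f : {p : V → Option (Sym2 V) // Function.Injective p ∧ S = Set.range p} ≃ (V ≃ S) :=
    { toFun := fun p => (Equiv.ofInjective p.1 p.2.1).trans (Equiv.setCongr p.2.2.symm)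
      invFun := fun e => ⟨fun v => (e v : Option (Sym2 V)),
        Subtype.val_injective.comp e.injective, by
          ext o
          constructor
          · intro ho
            exact ⟨e.symm ⟨o, ho⟩, by simp⟩
          · rintro ⟨v, rfl⟩
            exact (e v).2⟩
      left_inv := fun p => rfl
      right_inv := fun e => by ext; rfl }
  rw [Nat.card_congr f, Nat.card_eq_fintype_card, Fintype.card_equiv (Fintype.equivOfCardEq hc)]

/-- **Kirchhoff's matrix-tree theorem** for the Laplacian grounded at the vertex `r`, in factored
form. -/
theorem det_groundedIncMatrix_mul_diagonal_mul_transpose (r : V) (G : SimpleGraph V) (c t : ℝ)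
    (d : Option (Sym2 V) → ℝ) (hnone : d none = t) (hmem : ∀ e ∈ G.edgeSet, d (some e) = c)
    (hnot : ∀ e ∉ G.edgeSet, d (some e) = 0) :
    (realGroundedIncMatrix r * Matrix.diagonal d *
        (realGroundedIncMatrix r).transpose).det =
      t * c ^ (Fintype.card V - 1) *
        (Nat.card {T : SimpleGraph V // T ≤ G ∧ T.IsTree} : ℝ) := by
  classical
  have hfac : ((Fintype.card V).factorial : ℝ) ≠ 0 := by positivity
  apply mul_left_cancel₀ hfac
  rw [Matrix.factorial_mul_det_mul_diagonal_mul_transpose]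
  -- For each `p` at most one tree contributes, since a tree is determined by its `groundedEdgeSet`.
  have hterm : ∀ p : V → Option (Sym2 V),
      (∏ i, d (p i)) * ((realGroundedIncMatrix r).submatrix id p).det ^ 2 =
      ∑ T : {T : SimpleGraph V // T ≤ G ∧ T.IsTree},
        if Function.Injective p ∧ T.1.groundedEdgeSet = Set.range p then
          t * c ^ (Fintype.card V - 1) else 0 := by
    intro p
    have hcast : ((realGroundedIncMatrix r).submatrix id p).det =
        (((groundedIncMatrix r).submatrix id p).det : ℝ) := by
      rw [Int.cast_det]; rfl
    rw [hcast]
    by_cases h : ∃ T : {T : SimpleGraph V // T ≤ G ∧ T.IsTree},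
        Function.Injective p ∧ T.1.groundedEdgeSet = Set.range p
    · obtain ⟨T, hinj, hT⟩ := h
      rw [Finset.sum_eq_single T, if_pos ⟨hinj, hT⟩]
      · have hsq : (((groundedIncMatrix r).submatrix id p).det : ℝ) ^ 2 = 1 := by
          rcases Int.isUnit_iff.1 (isUnit_det_groundedIncMatrix_submatrix r T.2.2.1 hT.subset) with
            h | h <;> simp [h]
        rw [hsq, mul_one]
        obtain ⟨i₀, hi₀⟩ : none ∈ Set.range p := by
          rw [← hT]
          simp [groundedEdgeSet]
        -- The index mapped to `none` gives `t`; the other `Fintype.card V - 1` indices are mapped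
        -- to edges and give `c` each.
        rw [← Finset.mul_prod_erase _ _ (Finset.mem_univ i₀), hi₀, hnone,
          Finset.prod_congr rfl (g := fun _ => c), Finset.prod_const,
          Finset.card_erase_of_mem (Finset.mem_univ _), Finset.card_univ]
        intro i hi
        have hmem' : p i ∈ T.1.groundedEdgeSet := by
          rw [hT]
          exact ⟨i, rfl⟩
        rcases hmem' with h | ⟨e, he, h⟩
        · exact absurd (hinj (h.trans hi₀.symm)) (Finset.ne_of_mem_erase hi)
        · rw [← h]
          exact hmem e (edgeSet_subset_edgeSet.2 T.2.1 he)
      · intro T' _ hne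
        rw [if_neg]
        rintro ⟨-, h'⟩
        exact hne (Subtype.ext (groundedEdgeSet_injective (h'.trans hT.symm)))
      · simp
    · rw [Finset.sum_eq_zero]
      · by_contra hne
        have h1 := left_ne_zero_of_mul hne
        have h2 : ((groundedIncMatrix r).submatrix id p).det ≠ 0 := by
          intro h0
          exact hne (by simp [h0])
        rw [Finset.prod_ne_zero_iff] at h1
        obtain ⟨hinj, T, hTG, hT, hr⟩ :=
          exists_isTree_of_det_groundedIncMatrix_submatrix_ne_zero r G (fun i e hie => by
            by_contra he
            exact h1 i (Finset.mem_univ _) (by rw [hie, hnot e he])) h2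
        exact h ⟨⟨T, hTG, hT⟩, hinj, hr⟩
      · intro T _
        rw [if_neg fun h' => h ⟨T, h'⟩]
  rw [Finset.sum_congr rfl fun p _ => hterm p, Finset.sum_comm]
  have hfiber : ∀ T : {T : SimpleGraph V // T ≤ G ∧ T.IsTree},
      (∑ p : V → Option (Sym2 V),
        if Function.Injective p ∧ T.1.groundedEdgeSet = Set.range p then
          t * c ^ (Fintype.card V - 1) else 0) =
      (Fintype.card V).factorial * (t * c ^ (Fintype.card V - 1)) := by
    intro T
    have hcard := card_injective_range_eq T.1.groundedEdgeSet (by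
      rw [ncard_groundedEdgeSet, (isTree_iff_connected_and_card.1 T.2.2).2,
        Nat.card_eq_fintype_card])
    rw [← Finset.sum_filter, Finset.sum_const, nsmul_eq_mul, ← hcard, Nat.card_eq_fintype_card,
      Fintype.card_subtype]
  rw [Finset.sum_congr rfl fun T _ => hfiber T, Finset.sum_const, Finset.card_univ,
    Nat.card_eq_fintype_card]
  ring

end SimpleGraph

/-! ### The grounded Laplacian and its factorization. -/

namespace SimpleGraph

open Matrix

variable {V : Type*} [DecidableEq V] (G : SimpleGraph V) [DecidableRel G.Adj]

/-- The arbitrary orientation disappears in products: the two ends of an edge carry opposite signs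
whichever way it points. -/
theorem groundedIncMatrix_mul_of_mem_edgeSet (r u v : V) {e : Sym2 V} (he : e ∈ G.edgeSet) :
    (groundedIncMatrix r u (some e) : ℝ) * groundedIncMatrix r v (some e) =
      (if u = v then 1 else -1) * (G.incMatrix ℝ u e * G.incMatrix ℝ v e) := by
  induction e with
  | _ x y =>
    have hxy : x ≠ y := G.ne_of_adj he
    have hinc : ∀ w, G.incMatrix ℝ w s(x, y) = if w = x ∨ w = y then 1 else 0 := by
      intro w
      rw [incMatrix_apply']
      refine if_congr ?_ rfl rfl
      have hadj : G.Adj x y := he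
      simp [incidenceSet, hadj]
    rw [hinc, hinc]
    rcases groundedIncMatrix_some r x y with h | h <;>
    · have hu := congrFun h u
      have hv := congrFun h v
      beta_reduce at hu hv
      rw [hu, hv]
      simp only [Pi.sub_apply, Pi.single_apply]
      by_cases h1 : u = x <;> by_cases h2 : u = y <;> by_cases h3 : v = x <;>
        by_cases h4 : v = y <;> simp_all

variable [Fintype V]

theorem sum_incMatrix_mul_incMatrix (u v : V) :
    ∑ e, G.incMatrix ℝ u e * G.incMatrix ℝ v e =
      if u = v then (G.degree u : ℝ) else if G.Adj u v then 1 else 0 := by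
  have h := congrFun (congrFun (G.incMatrix_mul_transpose (R := ℝ)) u) v
  simpa [Matrix.mul_apply] using h

/-- The Laplacian scaled by `c` and grounded at `r` with weight `t`. -/
noncomputable def groundedLapMatrix (r : V) (c t : ℝ) : Matrix V V ℝ :=
  c • G.lapMatrix ℝ + Matrix.single r r t

/-- The weight `t` on the extra column, `c` on the edges of `G` and `0` on the other pairs. -/
def groundedWeight (c t : ℝ) : Option (Sym2 V) → ℝ :=
  fun o => o.elim t fun e => if e ∈ G.edgeSet then c else 0

theorem groundedIncMatrix_mul_diagonal_mul_transpose (r : V) (c t : ℝ) :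
    realGroundedIncMatrix r *
        Matrix.diagonal (G.groundedWeight c t) *
        (realGroundedIncMatrix r).transpose = G.groundedLapMatrix r c t := by
  ext u v
  rw [Matrix.mul_apply, Fintype.sum_option]
  simp only [Matrix.mul_diagonal, Matrix.transpose_apply, realGroundedIncMatrix, Matrix.map_apply, groundedWeight, Option.elim]
  have hsum : ∑ e, (groundedIncMatrix r u (some e) : ℝ) * (if e ∈ G.edgeSet then c else 0) *
      groundedIncMatrix r v (some e) =
      c * ((if u = v then 1 else -1) * ∑ e, G.incMatrix ℝ u e * G.incMatrix ℝ v e) := by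
    rw [Finset.mul_sum, Finset.mul_sum]
    refine Finset.sum_congr rfl fun e _ => ?_
    by_cases he : e ∈ G.edgeSet
    · rw [if_pos he, ← G.groundedIncMatrix_mul_of_mem_edgeSet r u v he]
      ring
    · have : G.incMatrix ℝ u e = 0 := G.incMatrix_of_notMem_incidenceSet fun h => he h.1
      simp [he, this]
  rw [hsum, sum_incMatrix_mul_incMatrix]
  have hu := congrFun (groundedIncMatrix_none r) u
  have hv := congrFun (groundedIncMatrix_none r) v
  beta_reduce at hu hv
  rw [hu, hv]
  simp only [groundedLapMatrix, lapMatrix, degMatrix, Matrix.add_apply, Matrix.smul_apply,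
    Matrix.sub_apply, Matrix.diagonal_apply, adjMatrix_apply, Matrix.single_apply, smul_eq_mul,
    Pi.single_apply]
  by_cases huv : u = v
  · subst huv
    by_cases hur : u = r
    · subst hur
      simp
      ring
    · simp [hur, Ne.symm hur]
  · have hr : ¬(r = u ∧ r = v) := fun h => huv (h.1.symm.trans h.2)
    have hr' : ((if u = r then (1 : ℤ) else 0) : ℝ) * (if v = r then (1 : ℤ) else 0 : ℤ) = 0 := by
      by_cases hur : u = r
      · have : v ≠ r := fun h => huv (hur.trans h.symm)
        simp [this]
      · simp [hur]
    simp only [huv, hr, if_false]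
    split_ifs <;> simp_all

end SimpleGraph

/-- **Kirchhoff's matrix-tree theorem**. -/
theorem SimpleGraph.det_groundedLapMatrix {V : Type} [Fintype V] [DecidableEq V]
    (G : SimpleGraph V) [DecidableRel G.Adj] (r : V) (c t : ℝ) :
    (G.groundedLapMatrix r c t).det =
      t * c ^ (Fintype.card V - 1) * (numSpanningTrees G : ℝ) := by
  rw [← groundedIncMatrix_mul_diagonal_mul_transpose,
    det_groundedIncMatrix_mul_diagonal_mul_transpose r G c t]
  · rfl
  · rfl
  · intro e he
    simp [groundedWeight, he]
  · intro e he
    simp [groundedWeight, he]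

/-! ### Two determinants attached to complete graphs. -/

open Matrix in
theorem Matrix.det_scalar_sub_ones (n : ℕ) {a : ℝ} (ha : a ≠ 0) :
    (a • (1 : Matrix (Fin n) (Fin n) ℝ) - Matrix.of fun _ _ => 1).det = a ^ n * (1 - n / a) := by
  have h : (a • (1 : Matrix (Fin n) (Fin n) ℝ) - Matrix.of fun _ _ => 1) =
      a • (1 - (Matrix.of fun _ _ => a⁻¹ : Matrix (Fin n) (Fin 1) ℝ) *
        (Matrix.of fun _ _ => 1 : Matrix (Fin 1) (Fin n) ℝ)) := by
    ext i j
    simp [Matrix.mul_apply, mul_sub, ha]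
  rw [h, Matrix.det_smul, Matrix.det_one_sub_mul_comm, Matrix.det_fin_one]
  simp [Matrix.mul_apply, div_eq_mul_inv]

theorem numSpanningTrees_top (n : ℕ) :
    numSpanningTrees (⊤ : SimpleGraph (Fin (n + 2))) = (n + 2) ^ n := by
  have ha : ((n : ℝ) + 2) ≠ 0 := by positivity
  have hdet := (⊤ : SimpleGraph (Fin (n + 2))).det_groundedLapMatrix 0 1 1
  -- The grounded Laplacian is `(n+2)I - J + E₀₀`, a rank-two perturbation of a scalar matrix;
  -- Sylvester's identity reduces it to a `2 × 2` determinant, equal to `(n+2)⁻²`.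
  let A : Matrix (Fin (n + 2)) (Fin 2) ℝ := Matrix.of fun i =>
    ![((n : ℝ) + 2)⁻¹, if i = 0 then -((n : ℝ) + 2)⁻¹ else 0]
  let B : Matrix (Fin 2) (Fin (n + 2)) ℝ := Matrix.of ![fun _ => 1, fun i => if i = 0 then 1 else 0]
  have h : (⊤ : SimpleGraph (Fin (n + 2))).groundedLapMatrix 0 1 1 =
      ((n : ℝ) + 2) • (1 - A * B) := by
    ext i j
    simp only [SimpleGraph.groundedLapMatrix, SimpleGraph.lapMatrix, SimpleGraph.degMatrix, A, B,
      Matrix.mul_apply, Fin.sum_univ_two, Matrix.single_apply, Matrix.one_apply,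
      Matrix.diagonal_apply, Matrix.add_apply, Matrix.sub_apply, Matrix.smul_apply,
      SimpleGraph.adjMatrix_apply, SimpleGraph.complete_graph_degree, SimpleGraph.top_adj]
    by_cases hij : i = j
    · subst hij
      by_cases hi : i = 0 <;> simp [hi, eq_comm (a := (0 : Fin (n + 2)))] <;> field_simp <;> ring
    · by_cases hi : i = 0 <;> by_cases hj : j = 0 <;>
        simp [hij, hi, hj, eq_comm (a := (0 : Fin (n + 2)))] <;> field_simp <;> simp_all
  have hBA : B * A = !![1, -((n : ℝ) + 2)⁻¹; ((n : ℝ) + 2)⁻¹, -((n : ℝ) + 2)⁻¹] := by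
    ext i j
    fin_cases i <;> fin_cases j <;> simp [A, B, Matrix.mul_apply, ha]
  rw [h, Matrix.det_smul, Matrix.det_one_sub_mul_comm, hBA, Matrix.det_fin_two] at hdet
  simp only [Fintype.card_fin, Matrix.sub_apply, Matrix.one_apply, Matrix.of_apply,
    Matrix.cons_val', Matrix.cons_val_zero, Matrix.cons_val_one, one_pow, one_mul] at hdet
  have : (numSpanningTrees (⊤ : SimpleGraph (Fin (n + 2))) : ℝ) = ((n : ℝ) + 2) ^ n := by
    rw [← hdet]
    simp
    field_simp
    ring
  exact_mod_cast this

/-! ### The Laplacian of an edge corona and its Schur complement. -/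

namespace SimpleGraph

variable {V : Type} [Fintype V] [DecidableEq V] (G : SimpleGraph V) [DecidableRel G.Adj]

theorem sum_edgeSet_mem_mul_mem (u v : V) :
    ∑ e : G.edgeSet, (if u ∈ (e : Sym2 V) then (1 : ℝ) else 0) *
      (if v ∈ (e : Sym2 V) then 1 else 0) =
      if u = v then (G.degree u : ℝ) else if G.Adj u v then 1 else 0 := by
  rw [← sum_incMatrix_mul_incMatrix, Finset.sum_set_coe G.edgeSet
    (f := fun e => (if u ∈ e then (1 : ℝ) else 0) * (if v ∈ e then 1 else 0)),
    ← Finset.sum_subset (Finset.subset_univ G.edgeSet.toFinset)]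
  · refine Finset.sum_congr rfl fun e he => ?_
    have he' : e ∈ G.edgeSet := Set.mem_toFinset.1 he
    simp [incMatrix_apply', incidenceSet, he']
  · intro e _ he
    have he' : e ∉ G.edgeSet := fun h => he (Set.mem_toFinset.2 h)
    simp [incMatrix_apply', incidenceSet, he']

theorem sum_edgeSet_mem (u : V) :
    ∑ e : G.edgeSet, (if u ∈ (e : Sym2 V) then (1 : ℝ) else 0) = G.degree u := by
  have h := G.sum_edgeSet_mem_mul_mem u u
  rw [if_pos rfl] at h
  rw [← h]
  exact Finset.sum_congr rfl fun e _ => by split_ifs <;> simp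

theorem sum_mem_edgeSet (e : G.edgeSet) :
    ∑ v : V, (if v ∈ (e : Sym2 V) then (1 : ℝ) else 0) = 2 := by
  rw [← G.sum_incMatrix_apply_of_mem_edgeSet (R := ℝ) e.2]
  refine Finset.sum_congr rfl fun v _ => ?_
  simp [incMatrix_apply', incidenceSet]

section edgeCorona

variable (q : ℕ) [DecidableRel (edgeCorona G (⊤ : SimpleGraph (Fin q))).Adj]

theorem degree_edgeCorona_inl (u : V) :
    ((edgeCorona G (⊤ : SimpleGraph (Fin q))).degree (Sum.inl u) : ℝ) = (q + 1) * G.degree u := by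
  rw [degree_eq_sum_if_adj, Fintype.sum_sum_type, Fintype.sum_prod_type]
  have h1 : ∀ v, (edgeCorona G (⊤ : SimpleGraph (Fin q))).Adj (Sum.inl u) (Sum.inl v) ↔
      G.Adj u v := fun _ => Iff.rfl
  have h2 : ∀ e w, (edgeCorona G (⊤ : SimpleGraph (Fin q))).Adj (Sum.inl u) (Sum.inr (e, w)) ↔
      u ∈ (e : Sym2 V) := fun _ _ => Iff.rfl
  simp only [h1, h2, Finset.sum_const, ← Finset.smul_sum, sum_edgeSet_mem,
    ← degree_eq_sum_if_adj]
  simp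
  ring

theorem degree_edgeCorona_inr (p : G.edgeSet × Fin q) :
    ((edgeCorona G (⊤ : SimpleGraph (Fin q))).degree (Sum.inr p) : ℝ) = q + 1 := by
  obtain ⟨e, w⟩ := p
  rw [degree_eq_sum_if_adj, Fintype.sum_sum_type, Fintype.sum_prod_type]
  have h1 : ∀ v, (edgeCorona G (⊤ : SimpleGraph (Fin q))).Adj (Sum.inr (e, w)) (Sum.inl v) ↔
      v ∈ (e : Sym2 V) := fun _ => Iff.rfl
  have h2 : ∀ e' w', (edgeCorona G (⊤ : SimpleGraph (Fin q))).Adj (Sum.inr (e, w))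
      (Sum.inr (e', w')) ↔ e = e' ∧ w ≠ w' := fun _ _ => Iff.rfl
  have h3 : ∑ w' : Fin q, (if w ≠ w' then (1 : ℝ) else 0) = q - 1 := by
    have h := (⊤ : SimpleGraph (Fin q)).degree_eq_sum_if_adj (R := ℝ) w
    simp only [top_adj, complete_graph_degree, Fintype.card_fin] at h
    rw [← h, Nat.cast_sub (Nat.one_le_of_lt w.2), Nat.cast_one]
  simp only [h1, h2, sum_mem_edgeSet, ite_and, Finset.sum_ite_irrel, h3, Finset.sum_const_zero]
  simp
  ring

open Matrix Kronecker

/-- Distinct copies are not adjacent, so the lower right block is a Kronecker product with the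
identity. Within a copy the diagonal is `q + 1` and all other entries are `-1`. -/
theorem groundedLapMatrix_edgeCorona (r : V) :
    (edgeCorona G (⊤ : SimpleGraph (Fin q))).groundedLapMatrix (Sum.inl r) 1 1 =
      Matrix.fromBlocks
        (((q : ℝ) + 1) • G.degMatrix ℝ - G.adjMatrix ℝ + Matrix.single r r 1)
        (Matrix.of fun u p => -(if u ∈ (p.1 : Sym2 V) then 1 else 0))
        (Matrix.of fun p u => -(if u ∈ (p.1 : Sym2 V) then 1 else 0))
        ((1 : Matrix G.edgeSet G.edgeSet ℝ) ⊗ₖ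
          (((q : ℝ) + 2) • (1 : Matrix (Fin q) (Fin q) ℝ) - Matrix.of fun _ _ => 1)) := by
  have h1 : ∀ u v, (edgeCorona G (⊤ : SimpleGraph (Fin q))).Adj (Sum.inl u) (Sum.inl v) ↔
      G.Adj u v := fun _ _ => Iff.rfl
  have h2 : ∀ u p, (edgeCorona G (⊤ : SimpleGraph (Fin q))).Adj (Sum.inl u) (Sum.inr p) ↔
      u ∈ (p.1 : Sym2 V) := fun _ _ => Iff.rfl
  have h3 : ∀ p v, (edgeCorona G (⊤ : SimpleGraph (Fin q))).Adj (Sum.inr p) (Sum.inl v) ↔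
      v ∈ (p.1 : Sym2 V) := fun _ _ => Iff.rfl
  have h4 : ∀ p p', (edgeCorona G (⊤ : SimpleGraph (Fin q))).Adj (Sum.inr p) (Sum.inr p') ↔
      p.1 = p'.1 ∧ p.2 ≠ p'.2 := fun _ _ => Iff.rfl
  ext x y
  rcases x with u | p <;> rcases y with v | p'
  · by_cases huv : u = v
    · subst huv
      simp [groundedLapMatrix, lapMatrix, degMatrix, degree_edgeCorona_inl, Matrix.single_apply]
    · simp [groundedLapMatrix, lapMatrix, degMatrix, h1, Matrix.single_apply, huv]
  · simp [groundedLapMatrix, lapMatrix, degMatrix, h2]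
  · simp [groundedLapMatrix, lapMatrix, degMatrix, h3]
  · obtain ⟨e, w⟩ := p
    obtain ⟨e', w'⟩ := p'
    by_cases he : e = e'
    · subst he
      by_cases hw : w = w'
      · subst hw
        simp [groundedLapMatrix, lapMatrix, degMatrix, degree_edgeCorona_inr]
        ring
      · simp [groundedLapMatrix, lapMatrix, degMatrix, h4, hw]
    · simp [groundedLapMatrix, lapMatrix, degMatrix, h4, he]

theorem det_groundedLapMatrix_edgeCorona (r : V) :
    ((edgeCorona G (⊤ : SimpleGraph (Fin q))).groundedLapMatrix (Sum.inl r) 1 1).det =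
      (G.groundedLapMatrix r (((q : ℝ) + 2) / 2) 1).det *
        (2 * ((q : ℝ) + 2) ^ q / ((q : ℝ) + 2)) ^ Fintype.card G.edgeSet := by
  have ha : ((q : ℝ) + 2) ≠ 0 := by positivity
  -- Each copy's block has row sums `2`, so it sends the vector with all entries `1/2` to the
  -- all-ones vector. This `X` therefore clears the lower left block with no matrix inverse.
  let X : Matrix (G.edgeSet × Fin q) V ℝ :=
    Matrix.of fun p u => 2⁻¹ * (if u ∈ (p.1 : Sym2 V) then 1 else 0)
  have hX : (Matrix.fromBlocks (1 : Matrix V V ℝ) 0 X 1).det = 1 := by simp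
  rw [groundedLapMatrix_edgeCorona]
  refine (mul_one _).symm.trans ?_
  rw [← hX, ← Matrix.det_mul, hX, Matrix.fromBlocks_multiply]
  simp only [Matrix.mul_one, Matrix.mul_zero, zero_add]
  have hC : (Matrix.of fun (p : G.edgeSet × Fin q) (u : V) =>
        -(if u ∈ (p.1 : Sym2 V) then (1 : ℝ) else 0)) +
      ((1 : Matrix G.edgeSet G.edgeSet ℝ) ⊗ₖ
        (((q : ℝ) + 2) • (1 : Matrix (Fin q) (Fin q) ℝ) - Matrix.of fun _ _ => 1)) * X = 0 := by
    have hrow : ∀ w : Fin q, ∑ w', (((q : ℝ) + 2) • (1 : Matrix (Fin q) (Fin q) ℝ) -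
        (Matrix.of fun _ _ => 1 : Matrix (Fin q) (Fin q) ℝ)) w w' = 2 := by
      intro w
      simp [Finset.sum_sub_distrib, Matrix.one_apply]
    ext ⟨e, w⟩ u
    rw [Matrix.add_apply, Matrix.mul_apply, Fintype.sum_prod_type, Finset.sum_eq_single e]
    · have hsum : ∑ w', ((1 : Matrix G.edgeSet G.edgeSet ℝ) ⊗ₖ
            (((q : ℝ) + 2) • (1 : Matrix (Fin q) (Fin q) ℝ) - Matrix.of fun _ _ => 1))
              (e, w) (e, w') * X (e, w') u = if u ∈ (e : Sym2 V) then 1 else 0 := by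
        rw [← mul_inv_cancel_left₀ (two_ne_zero' ℝ) (if u ∈ (e : Sym2 V) then 1 else 0), ← hrow w,
          Finset.sum_mul]
        refine Finset.sum_congr rfl fun w' _ => ?_
        simp only [Matrix.kroneckerMap_apply, Matrix.one_apply_eq, one_mul, X, Matrix.of_apply,
          hrow]
      rw [hsum]
      simp
    · intro e' _ he
      simp [he.symm]
    · simp
  -- The Schur complement: `(q+1)D - A - (q/2)(D + A) = ((q+2)/2)(D - A)`, the grounding term being
  -- untouched.
  have hA : (((q : ℝ) + 1) • G.degMatrix ℝ - G.adjMatrix ℝ + Matrix.single r r 1) +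
      (Matrix.of fun (u : V) (p : G.edgeSet × Fin q) =>
        -(if u ∈ (p.1 : Sym2 V) then (1 : ℝ) else 0)) * X =
      G.groundedLapMatrix r (((q : ℝ) + 2) / 2) 1 := by
    ext u v
    have h : ((Matrix.of fun (u : V) (p : G.edgeSet × Fin q) =>
        -(if u ∈ (p.1 : Sym2 V) then (1 : ℝ) else 0)) * X) u v =
        -(q / 2) * if u = v then (G.degree u : ℝ) else if G.Adj u v then 1 else 0 := by
      rw [← sum_edgeSet_mem_mul_mem, Matrix.mul_apply, Fintype.sum_prod_type, Finset.mul_sum]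
      refine Finset.sum_congr rfl fun e _ => ?_
      trans ∑ _w : Fin q, -2⁻¹ *
        ((if u ∈ (e : Sym2 V) then (1 : ℝ) else 0) * (if v ∈ (e : Sym2 V) then 1 else 0))
      · refine Finset.sum_congr rfl fun w _ => ?_
        simp only [X, Matrix.of_apply]
        ring
      · rw [Finset.sum_const, Finset.card_univ, Fintype.card_fin, nsmul_eq_mul]
        ring
    rw [Matrix.add_apply, h]
    by_cases huv : u = v
    · subst huv
      simp [groundedLapMatrix, lapMatrix, degMatrix]
      ring
    · by_cases hadj : G.Adj u v <;>
        simp [groundedLapMatrix, lapMatrix, degMatrix, huv, hadj] <;> ring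
  rw [hC, hA, Matrix.det_fromBlocks_zero₂₁, Matrix.det_kronecker, Matrix.det_one, one_pow, one_mul,
    Matrix.det_scalar_sub_ones q ha]
  congr 2
  field_simp
  ring

end edgeCorona

end SimpleGraph

/-! ### Edge count and spanning tree recursion for one corona step. -/

/-- Handshake count: old vertices contribute `(q+1) * 2M` and the `qM` new ones `q+1` each. -/
theorem two_mul_card_edgeSet_edgeCorona {V : Type} [Finite V] (G : SimpleGraph V) (q : ℕ) :
    2 * Nat.card (edgeCorona G (⊤ : SimpleGraph (Fin q))).edgeSet =
      (q + 1) * (q + 2) * Nat.card G.edgeSet := by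
  classical
  have := Fintype.ofFinite V
  have h1 := (edgeCorona G (⊤ : SimpleGraph (Fin q))).sum_degrees_eq_twice_card_edges
  have h2 := G.sum_degrees_eq_twice_card_edges
  rw [SimpleGraph.edgeFinset_card, ← Nat.card_eq_fintype_card] at h1 h2
  rw [Fintype.sum_sum_type] at h1
  have h3 : ((∑ v, (edgeCorona G (⊤ : SimpleGraph (Fin q))).degree (Sum.inl v) : ℕ) : ℝ) =
      (q + 1) * (2 * Nat.card G.edgeSet) := by
    push_cast
    simp only [SimpleGraph.degree_edgeCorona_inl, ← Finset.mul_sum]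
    congr 1
    exact_mod_cast h2
  have h4 : ((∑ p, (edgeCorona G (⊤ : SimpleGraph (Fin q))).degree (Sum.inr p) : ℕ) : ℝ) =
      Nat.card G.edgeSet * q * (q + 1) := by
    push_cast
    simp only [SimpleGraph.degree_edgeCorona_inr]
    simp
    ring
  have h5 : ((2 * Nat.card (edgeCorona G (⊤ : SimpleGraph (Fin q))).edgeSet : ℕ) : ℝ) =
      ((q + 1) * (q + 2) * Nat.card G.edgeSet : ℕ) := by
    rw [← h1, Nat.cast_add, h3, h4]
    push_cast
    ring
  exact_mod_cast h5

/-- The exponents are integers because `G` need not be connected, so `M - N + 1` may be negative. -/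
theorem numSpanningTrees_edgeCorona {V : Type} [Finite V] [Nonempty V] (G : SimpleGraph V)
    (q : ℕ) :
    (numSpanningTrees (edgeCorona G (⊤ : SimpleGraph (Fin q))) : ℝ) =
      (2 : ℝ) ^ ((Nat.card G.edgeSet : ℤ) - (Nat.card V : ℤ) + 1) *
        ((q : ℝ) + 2) ^ (((q : ℤ) - 1) * (Nat.card G.edgeSet : ℤ) + (Nat.card V : ℤ) - 1) *
          (numSpanningTrees G : ℝ) := by
  classical
  have := Fintype.ofFinite V
  obtain ⟨r⟩ := ‹Nonempty V›
  have ha : ((q : ℝ) + 2) ≠ 0 := by positivity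
  have h := G.det_groundedLapMatrix_edgeCorona q r
  rw [SimpleGraph.det_groundedLapMatrix, SimpleGraph.det_groundedLapMatrix] at h
  simp only [one_pow, one_mul] at h
  rw [h, ← Nat.card_eq_fintype_card (α := V), ← Nat.card_eq_fintype_card (α := G.edgeSet)]
  obtain ⟨n, hn⟩ : ∃ n, Nat.card V = n + 1 := Nat.exists_eq_succ_of_ne_zero Nat.card_pos.ne'
  have e1 : ((Nat.card G.edgeSet : ℤ) - ((n + 1 : ℕ) : ℤ) + 1) = Nat.card G.edgeSet - (n : ℤ) := by
    push_cast
    ring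
  have e2 : (((q : ℤ) - 1) * (Nat.card G.edgeSet : ℤ) + ((n + 1 : ℕ) : ℤ) - 1) =
      ((q * Nat.card G.edgeSet : ℕ) : ℤ) - Nat.card G.edgeSet + n := by
    push_cast
    ring
  rw [hn, e1, e2, zpow_sub₀ two_ne_zero, zpow_add₀ ha, zpow_sub₀ ha]
  simp only [zpow_natCast, Nat.add_sub_cancel, div_pow, mul_pow, ← pow_mul]
  ring

/-! ### The iterated network: order, size and closed form. -/

instance finite_simplicialVertex (q g : ℕ) : Finite (SimplicialVertex q g) := by
  induction g with
  | zero => exact inferInstanceAs (Finite (Fin (q + 2)))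
  | succ g ih => exact inferInstanceAs (Finite (SimplicialVertex q g ⊕ (_ × Fin q)))

instance nonempty_simplicialVertex (q g : ℕ) : Nonempty (SimplicialVertex q g) := by
  induction g with
  | zero => exact inferInstanceAs (Nonempty (Fin (q + 2)))
  | succ g ih => exact ih.map Sum.inl

theorem simplicialOrder_succ (q g : ℕ) :
    simplicialOrder q (g + 1) = simplicialOrder q g + q * simplicialSize q g := by
  have h : simplicialOrder q (g + 1) =
      Nat.card (SimplicialVertex q g ⊕ ((simplicialGraph q g).edgeSet × Fin q)) := rfl
  rw [h, Nat.card_sum, Nat.card_prod, Nat.card_eq_fintype_card (α := Fin q), Fintype.card_fin,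
    mul_comm]
  rfl

theorem simplicialSize_eq (q g : ℕ) :
    (simplicialSize q g : ℝ) = (((q : ℝ) + 1) * ((q : ℝ) + 2) / 2) ^ (g + 1) := by
  induction g with
  | zero =>
    have h : simplicialSize q 0 = Nat.card (⊤ : SimpleGraph (Fin (q + 2))).edgeSet := rfl
    rw [h, Nat.card_eq_fintype_card, ← SimpleGraph.edgeFinset_card,
      SimpleGraph.card_edgeFinset_top_eq_card_choose_two, Fintype.card_fin, Nat.cast_choose_two]
    push_cast
    ring
  | succ g ih =>
    have h := two_mul_card_edgeSet_edgeCorona (simplicialGraph q g) q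
    have h' : 2 * simplicialSize q (g + 1) = (q + 1) * (q + 2) * simplicialSize q g := h
    have h'' : 2 * (simplicialSize q (g + 1) : ℝ) = (q + 1) * (q + 2) * simplicialSize q g := by
      exact_mod_cast h'
    rw [pow_succ, ← ih]
    linarith

/-- A geometric sum whose ratio minus one is `q(q+3)/2`; the increment factor `q` cancels, leaving
`2/(q+3)`. -/
theorem simplicialOrder_eq (q g : ℕ) :
    (simplicialOrder q g : ℝ) = q + 2 + 2 / ((q : ℝ) + 3) *
      ((((q : ℝ) + 1) * ((q : ℝ) + 2) / 2) ^ (g + 1) - ((q : ℝ) + 1) * ((q : ℝ) + 2) / 2) := by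
  induction g with
  | zero =>
    have h : simplicialOrder q 0 = Nat.card (Fin (q + 2)) := rfl
    rw [h, Nat.card_eq_fintype_card, Fintype.card_fin]
    push_cast
    ring
  | succ g ih =>
    rw [simplicialOrder_succ, Nat.cast_add, Nat.cast_mul, simplicialSize_eq, ih]
    field_simp
    ring

theorem theorem4 (q : ℕ) (hq : 1 ≤ q) :
    (∀ g : ℕ,
      (numSpanningTrees (simplicialGraph q g) : ℝ) =
        (2 : ℝ) ^
            (2 * ((q : ℝ) + 1) / (q * ((q : ℝ) + 3) ^ 2)
                * (((q : ℝ) + 1) * ((q : ℝ) + 2) / 2) ^ (g + 1)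
              - ((q : ℝ) + 1) / ((q : ℝ) + 3) * (g : ℝ)
              - ((q : ℝ) + 1) ^ 2 * ((q : ℝ) + 2) / (q * ((q : ℝ) + 3) ^ 2))
          * ((q : ℝ) + 2) ^
            (2 * ((q : ℝ) ^ 2 + 2 * q - 1) / (q * ((q : ℝ) + 3) ^ 2)
                * (((q : ℝ) + 1) * ((q : ℝ) + 2) / 2) ^ (g + 1)
              + ((q : ℝ) + 1) / ((q : ℝ) + 3) * (g : ℝ)
              + ((q : ℝ) ^ 3 + 2 * (q : ℝ) ^ 2 - q + 2) / (q * ((q : ℝ) + 3) ^ 2))) ∧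
    numSpanningTrees (simplicialGraph q 0) = (q + 2) ^ q ∧
    (∀ g : ℕ,
      (numSpanningTrees (simplicialGraph q (g + 1)) : ℝ) =
        (2 : ℝ) ^ ((simplicialSize q g : ℤ) - (simplicialOrder q g : ℤ) + 1)
          * ((q : ℝ) + 2) ^
            (((q : ℤ) - 1) * (simplicialSize q g : ℤ) + (simplicialOrder q g : ℤ) - 1)
          * (numSpanningTrees (simplicialGraph q g) : ℝ)) := by
  have hbase : numSpanningTrees (simplicialGraph q 0) = (q + 2) ^ q := numSpanningTrees_top q
  have hrec := fun g => numSpanningTrees_edgeCorona (simplicialGraph q g) q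
  refine ⟨fun g => ?_, hbase, hrec⟩
  have hq0 : (q : ℝ) ≠ 0 := by positivity
  have hq2 : 0 < (q : ℝ) + 2 := by positivity
  have hq3 : (q : ℝ) + 3 ≠ 0 := by positivity
  induction g with
  | zero =>
    have e1 : 2 * ((q : ℝ) + 1) / (q * ((q : ℝ) + 3) ^ 2)
                * (((q : ℝ) + 1) * ((q : ℝ) + 2) / 2) ^ (0 + 1)
              - ((q : ℝ) + 1) / ((q : ℝ) + 3) * ((0 : ℕ) : ℝ)
              - ((q : ℝ) + 1) ^ 2 * ((q : ℝ) + 2) / (q * ((q : ℝ) + 3) ^ 2) = 0 := by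
      push_cast
      field_simp
      ring
    have e2 : 2 * ((q : ℝ) ^ 2 + 2 * q - 1) / (q * ((q : ℝ) + 3) ^ 2)
                * (((q : ℝ) + 1) * ((q : ℝ) + 2) / 2) ^ (0 + 1)
              + ((q : ℝ) + 1) / ((q : ℝ) + 3) * ((0 : ℕ) : ℝ)
              + ((q : ℝ) ^ 3 + 2 * (q : ℝ) ^ 2 - q + 2) / (q * ((q : ℝ) + 3) ^ 2) = q := by
      push_cast
      field_simp
      ring
    rw [e1, e2, hbase, Real.rpow_zero, one_mul, Real.rpow_natCast]
    push_cast
    rfl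
  | succ g ih =>
    have h := hrec g
    change (numSpanningTrees (simplicialGraph q (g + 1)) : ℝ) =
      (2 : ℝ) ^ ((simplicialSize q g : ℤ) - (simplicialOrder q g : ℤ) + 1) *
        ((q : ℝ) + 2) ^
          (((q : ℤ) - 1) * (simplicialSize q g : ℤ) + (simplicialOrder q g : ℤ) - 1) *
        (numSpanningTrees (simplicialGraph q g) : ℝ) at h
    rw [h, ih, ← Real.rpow_intCast, ← Real.rpow_intCast, mul_mul_mul_comm,
      ← Real.rpow_add two_pos, ← Real.rpow_add hq2]
    push_cast
    rw [simplicialSize_eq, simplicialOrder_eq, pow_succ _ (g + 1)]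
    -- With the edge count as a free variable `x`, both exponent comparisons become identities of
    -- rational functions in `q`, `g` and `x`.
    generalize (((q : ℝ) + 1) * ((q : ℝ) + 2) / 2) ^ (g + 1) = x
    congr 2
    · field_simp
      ring
    · field_simp
      ring
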